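/- Let $T>0$, $0<\varkappa<1$, $0<R_0\le R_1$, $C_0>0$ and $C_1>0$. There exist positive constants $C_2,C_3$, depending only on $\varkappa,T,R_0,R_1,C_0,C_1$, with the following property. Let $\mathbf L\subset\mathbb Z$ and let $\{\lambda_n\}_{n\in\mathbf L}$ be complex numbers with $\operatorname{Im}\lambda_n\ge 0$. Suppose there is a function $\nu:[0,\infty)\to[0,\infty)$ such that $$\#\{n\in\mathbf L:\ n\ne k,\ |\lambda_n-\lambda_k|<r\}\le\nu(r)\qquad\text{for all }k\in\mathbf L,\ r\ge 0,$$ $$\nu(r)=0\ \text{ for } 0\le r<R_0,\qquad C_0r^{\varkappa}\le\nu(r)\le C_1r^{\varkappa}\ \text{ for } r\ge R_1.$$ Write $\langle f,g\rangle=\int_0^Tf(t)\overline{g(t)}\,dt$. Then there exist functions $g_{m,1},g_{m,2}\in L^2(0,T)$, $m\in\mathbf L$, such that for all $m,n\in\mathbf L$ $$\langle g_{m,1},te^{i\lambda_nt}\rangle=0,\quad \langle g_{m,1},e^{i\lambda_nt}\rangle=\delta_{m,n},\quad \langle g_{m,2},te^{i\lambda_nt}\rangle=\delta_{m,n},\quad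 \langle g_{m,2},e^{i\lambda_nt}\rangle=0,$$ and, for all $m\in\mathbf L$ and $j=1,2$, $$\|g_{m,j}\|_{L^2(0,T)}\le C_2\,e^{C_3(\operatorname{Im}\lambda_m)^{\varkappa}}.$$ -/

import Mathlib

/-- The pairing `⟨f, g⟩ = ∫₀ᵀ f(t) conj(g(t)) dt`. -/
noncomputable def pairing (T : ℝ) (f g : ℝ → ℂ) : ℂ :=
  ∫ t in (0 : ℝ)..T, f t * (starRingEnd ℂ) (g t)

/-- The exponential `t ↦ e^{iμt}`. -/
noncomputable def expFun (μ : ℂ) : ℝ → ℂ := fun t => Complex.exp (Complex.I * μ * t)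

/-- The function `t ↦ t e^{iμt}`. -/
noncomputable def tExpFun (μ : ℂ) : ℝ → ℂ := fun t => (t : ℂ) * Complex.exp (Complex.I * μ * t)

/-- `ν : [0,∞) → [0,∞)` bounds the density of the frequencies `lam n`, `n ∈ L`: around every
`lam k` there are at most `ν r` other frequencies, counted by their index, at distance less than
`r`. Only the values of `ν` on `[0,∞)` are used. -/
structure IsDensityBound {L : Set ℤ} (lam : L → ℂ) (ν : ℝ → ℝ) : Prop where
  nonneg : ∀ r : ℝ, 0 ≤ r → 0 ≤ ν r
  finite : ∀ r : ℝ, 0 ≤ r → ∀ k : L, {n : L | n ≠ k ∧ ‖lam n - lam k‖ < r}.Finite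
  card_le : ∀ r : ℝ, 0 ≤ r → ∀ k : L, ({n : L | n ≠ k ∧ ‖lam n - lam k‖ < r}.ncard : ℝ) ≤ ν r

/-- `f ∈ L²(0,T)`. -/
def MemL2 (T : ℝ) (f : ℝ → ℂ) : Prop :=
  MeasureTheory.MemLp f 2 (MeasureTheory.volume.restrict (Set.Ioo 0 T))

/-- The norm of `L²(0,T)`; it is used for elements of `L²(0,T)` only. -/
noncomputable def normL2 (T : ℝ) (f : ℝ → ℂ) : ℝ :=
  (MeasureTheory.eLpNorm f 2 (MeasureTheory.volume.restrict (Set.Ioo 0 T))).toReal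

/-! For `f` supported in `[0, T]`, pairing with `e^{iλt}` and `te^{iλt}` gives `ft f` and `i` times
its derivative at the conjugate of `λ`. So for each `m` one needs a transform with double zeros at
the conjugates of all `λ n`, `n ≠ m`, with prescribed value and derivative at `p`, the conjugate of
`λ m`, and with norm controlled by `b = Im (λ m)`.

For finitely many nodes `p + μ i`, put `w = z - p` and expand `∏ (1 - w / μ i) ^ 2` in powers of
`w`. The density bound gives `∏ (1 + r / |μ i|) ≤ exp (O(1 + r ^ κ))`, so the coefficient of `w ^ k`
is at most about `e^{Ak} k^{-k/κ}`. Multiply by a product of box transforms of lengths `a j ≈ δ j ^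
(-1/κ)`, summable because `κ < 1`. Each factor `w` is absorbed by one box at cost `2 / a j + b`, so
`w ^ k` costs about `(2/δ)^k k^{k/κ}` times `exp (O(1 + b ^ κ))`. For `δ` large the expansion is
dominated by a geometric series, uniformly in the number of nodes (`exists_transform_of_card_le`).
Normalizing at `p` costs another `exp (O(1 + b ^ κ))`, since a box transform there has modulus at
least `1 / (1 + a j * b)`.

Two linear combinations of the result and its product with `w` solve the finite problems
(`exists_window_of_card_le`). As the bound does not depend on the finite set, weak-* compactness
gives all conditions at once (`exists_inner_eq_of_finite`). -/

/-! ### Transforms of bounded compactly supported functions. -/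

/-- The Fourier–Laplace transform `z ↦ ∫ f(t) e^{-izt} dt`. -/
noncomputable def ft (f : ℝ → ℂ) (z : ℂ) : ℂ :=
  ∫ t, f t * Complex.exp (-(Complex.I * z * t))

/-- `f` is measurable, bounded by `c`, and vanishes outside `[0, τ]`. -/
structure IsWindow (τ c : ℝ) (f : ℝ → ℂ) : Prop where
  meas : Measurable f
  bound : ∀ t, ‖f t‖ ≤ c
  supp : ∀ t, t ∉ Set.Icc 0 τ → f t = 0

/-- `G` is the transform of a function bounded by `c` and supported in `[0, τ]`. -/
def IsTransform (τ c : ℝ) (G : ℂ → ℂ) : Prop :=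
  ∃ f, IsWindow τ c f ∧ ∀ z, ft f z = G z

/-- The transform of the uniform probability density on `[0, a]`. -/
noncomputable def boxFT (a : ℝ) (z : ℂ) : ℂ :=
  (a : ℂ)⁻¹ * ∫ s in (0 : ℝ)..a, Complex.exp (-(Complex.I * z * s))

lemma IsWindow.nonneg {τ c : ℝ} {f : ℝ → ℂ} (h : IsWindow τ c f) : 0 ≤ c :=
  (norm_nonneg _).trans (h.bound 0)

lemma IsWindow.integrable_mul {τ c : ℝ} {f g : ℝ → ℂ} (h : IsWindow τ c f) (hg : Continuous g) :
    MeasureTheory.Integrable (fun t => f t * g t) := by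
  have h1 : MeasureTheory.IntegrableOn (fun t => f t * g t) (Set.Icc 0 τ) := by
    refine MeasureTheory.Integrable.bdd_mul (c := c) ?_ h.meas.aestronglyMeasurable
      (Filter.Eventually.of_forall h.bound)
    exact hg.continuousOn.integrableOn_Icc
  refine h1.integrable_of_forall_notMem_eq_zero fun t ht => ?_
  simp [h.supp t ht]

lemma continuous_kernel (z : ℂ) : Continuous fun t : ℝ => Complex.exp (-(Complex.I * z * t)) := by
  fun_prop

lemma IsWindow.integrable_ft {τ c : ℝ} {f : ℝ → ℂ} (h : IsWindow τ c f) (z : ℂ) :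
    MeasureTheory.Integrable (fun t : ℝ => f t * Complex.exp (-(Complex.I * z * t))) :=
  h.integrable_mul (continuous_kernel z)

lemma IsWindow.mono {τ τ' c c' : ℝ} {f : ℝ → ℂ} (h : IsWindow τ c f) (hτ : τ ≤ τ') (hc : c ≤ c') :
    IsWindow τ' c' f :=
  ⟨h.meas, fun t => (h.bound t).trans hc,
    fun t ht => h.supp t fun h' => ht ⟨h'.1, h'.2.trans hτ⟩⟩

lemma IsTransform.mono {τ τ' c c' : ℝ} {G : ℂ → ℂ} (h : IsTransform τ c G) (hτ : τ ≤ τ')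
    (hc : c ≤ c') : IsTransform τ' c' G := by
  obtain ⟨f, hf, hG⟩ := h
  exact ⟨f, hf.mono hτ hc, hG⟩

lemma IsTransform.nonneg {τ c : ℝ} {G : ℂ → ℂ} (h : IsTransform τ c G) : 0 ≤ c := by
  obtain ⟨f, hf, -⟩ := h
  exact hf.nonneg

lemma isTransform_zero (τ : ℝ) : IsTransform τ 0 (fun _ => 0) :=
  ⟨fun _ => 0, ⟨measurable_const, by simp, by simp⟩, by simp [ft]⟩

lemma IsTransform.add {τ c c' : ℝ} {G G' : ℂ → ℂ} (h : IsTransform τ c G)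
    (h' : IsTransform τ c' G') : IsTransform τ (c + c') (fun z => G z + G' z) := by
  obtain ⟨f, hf, hG⟩ := h
  obtain ⟨f', hf', hG'⟩ := h'
  refine ⟨fun t => f t + f' t, ⟨hf.meas.add hf'.meas,
    fun t => (norm_add_le _ _).trans (add_le_add (hf.bound t) (hf'.bound t)),
    fun t ht => by simp [hf.supp t ht, hf'.supp t ht]⟩, fun z => ?_⟩
  beta_reduce
  rw [← hG, ← hG', ft, ft, ft,
    ← MeasureTheory.integral_add (hf.integrable_ft z) (hf'.integrable_ft z)]
  simp only [add_mul]

lemma IsTransform.const_mul {τ c : ℝ} {G : ℂ → ℂ} (h : IsTransform τ c G) (α : ℂ) :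
    IsTransform τ (‖α‖ * c) (fun z => α * G z) := by
  obtain ⟨f, hf, hG⟩ := h
  refine ⟨fun t => α * f t, ⟨hf.meas.const_mul α, fun t => ?_,
    fun t ht => by simp [hf.supp t ht]⟩, fun z => ?_⟩
  · rw [norm_mul]
    exact mul_le_mul_of_nonneg_left (hf.bound t) (norm_nonneg _)
  · beta_reduce
    rw [← hG, ft, ft, ← MeasureTheory.integral_const_mul]
    simp only [mul_assoc]

lemma isTransform_sum {ι : Type*} (S : Finset ι) {τ : ℝ} {c : ι → ℝ} {G : ι → ℂ → ℂ}
    (h : ∀ i ∈ S, IsTransform τ (c i) (G i)) :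
    IsTransform τ (∑ i ∈ S, c i) (fun z => ∑ i ∈ S, G i z) := by
  classical
  induction S using Finset.induction_on with
  | empty => simpa using isTransform_zero τ
  | insert i S hi ih =>
    simp only [Finset.sum_insert hi]
    exact (h i (Finset.mem_insert_self _ _)).add
      (ih fun j hj => h j (Finset.mem_insert_of_mem hj))

/-- Modulation by a unimodular exponential keeps the sup bound. An imaginary shift would not, which
is why the depth `b` stays explicit in all later estimates. -/
lemma IsTransform.comp_sub_real {τ c : ℝ} {G : ℂ → ℂ} (h : IsTransform τ c G) (x : ℝ) :
    IsTransform τ c (fun z => G (z - x)) := by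
  obtain ⟨f, hf, hG⟩ := h
  refine ⟨fun t => f t * Complex.exp (((x * t : ℝ) : ℂ) * Complex.I), ⟨?_, fun t => ?_,
    fun t ht => by simp [hf.supp t ht]⟩, fun z => ?_⟩
  · exact hf.meas.mul (Continuous.measurable (by fun_prop))
  · rw [norm_mul, Complex.norm_exp_ofReal_mul_I, mul_one]
    exact hf.bound t
  · beta_reduce
    rw [← hG, ft, ft]
    congr 1
    ext t
    rw [mul_assoc, ← Complex.exp_add]
    congr 2
    push_cast
    ring

lemma isTransform_box {a : ℝ} (ha : 0 < a) : IsTransform a a⁻¹ (boxFT a) := by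
  refine ⟨(Set.Ioc 0 a).indicator fun _ => (a : ℂ)⁻¹,
    ⟨measurable_const.indicator measurableSet_Ioc, fun t => ?_, fun t ht => ?_⟩, fun z => ?_⟩
  · refine (norm_indicator_le_norm_self _ _).trans ?_
    simp [abs_of_pos ha]
  · rw [Set.indicator_of_notMem]
    exact fun h => ht ⟨h.1.le, h.2⟩
  · rw [ft, boxFT, intervalIntegral.integral_of_le ha.le, ← MeasureTheory.integral_const_mul,
      ← MeasureTheory.integral_indicator measurableSet_Ioc]
    congr 1
    ext t
    by_cases ht : t ∈ Set.Ioc 0 a <;> simp [ht]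

/-- Convolution with a probability density on `[0, a]` lengthens the support by `a` and does not
increase the sup norm. -/
lemma IsTransform.mul_box {τ c a : ℝ} {G : ℂ → ℂ} (h : IsTransform τ c G) (ha : 0 < a) :
    IsTransform (τ + a) c (fun z => boxFT a z * G z) := by
  obtain ⟨f, hf, hG⟩ := h
  have hmeas : Measurable fun p : ℝ × ℝ => f (p.1 - p.2) :=
    hf.meas.comp (measurable_fst.sub measurable_snd)
  refine ⟨fun t => (a : ℂ)⁻¹ * ∫ s in (0 : ℝ)..a, f (t - s), ⟨?_, fun t => ?_, fun t ht => ?_⟩,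
    fun z => ?_⟩
  · refine Measurable.const_mul ?_ _
    simp only [intervalIntegral.integral_of_le ha.le]
    exact (hmeas.stronglyMeasurable.integral_prod_right
      (ν := MeasureTheory.volume.restrict (Set.Ioc 0 a))).measurable
  · have h1 : ‖∫ s in (0 : ℝ)..a, f (t - s)‖ ≤ c * |a - 0| :=
      intervalIntegral.norm_integral_le_of_norm_le_const fun s _ => hf.bound _
    rw [sub_zero, abs_of_pos ha] at h1
    rw [norm_mul, norm_inv, Complex.norm_real, Real.norm_of_nonneg ha.le]
    calc a⁻¹ * _ ≤ a⁻¹ * (c * a) := by gcongr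
      _ = c := by field_simp
  · rw [intervalIntegral.integral_congr (g := fun _ => 0)]
    · simp
    · intro s hs
      rw [Set.uIcc_of_le ha.le] at hs
      refine hf.supp _ fun h' => ht ⟨?_, ?_⟩
      · linarith [h'.1, hs.1]
      · linarith [h'.2, hs.2]
  · have hker : Continuous fun t : ℝ => Complex.exp (-(Complex.I * z * t)) := continuous_kernel z
    have hint : MeasureTheory.Integrable (Function.uncurry fun t s : ℝ =>
        f (t - s) * Complex.exp (-(Complex.I * z * t)))
        (MeasureTheory.volume.prod (MeasureTheory.volume.restrict (Set.Ioc 0 a))) := by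
      have hm : Measurable (Function.uncurry fun t s : ℝ =>
          f (t - s) * Complex.exp (-(Complex.I * z * t))) :=
        hmeas.mul (hker.measurable.comp measurable_fst)
      have h1 : MeasureTheory.IntegrableOn (Function.uncurry fun t s : ℝ =>
          f (t - s) * Complex.exp (-(Complex.I * z * t))) (Set.Icc 0 (τ + a) ×ˢ Set.Ioc 0 a)
          (MeasureTheory.volume.prod MeasureTheory.volume) := by
        have h2 : MeasureTheory.IntegrableOn
            (fun p : ℝ × ℝ => Complex.exp (-(Complex.I * z * p.1)))
            (Set.Icc 0 (τ + a) ×ˢ Set.Ioc 0 a)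
            (MeasureTheory.volume.prod MeasureTheory.volume) := by
          have h3 : ContinuousOn (fun p : ℝ × ℝ => Complex.exp (-(Complex.I * z * p.1)))
              (Set.Icc 0 (τ + a) ×ˢ Set.Icc 0 a) := by fun_prop
          exact (h3.integrableOn_compact (isCompact_Icc.prod isCompact_Icc)).mono_set
            (Set.prod_mono le_rfl Set.Ioc_subset_Icc_self)
        exact MeasureTheory.Integrable.bdd_mul (c := c) h2 hmeas.aestronglyMeasurable
          (Filter.Eventually.of_forall fun p => hf.bound _)
      have h4 : MeasureTheory.IntegrableOn (Function.uncurry fun t s : ℝ =>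
          f (t - s) * Complex.exp (-(Complex.I * z * t))) (Set.univ ×ˢ Set.Ioc 0 a)
          (MeasureTheory.volume.prod MeasureTheory.volume) := by
        refine h1.of_forall_sdiff_eq_zero (MeasurableSet.univ.prod measurableSet_Ioc) ?_
        rintro ⟨t, s⟩ ⟨⟨-, hs⟩, hn⟩
        simp only [Function.uncurry_apply_pair]
        rw [hf.supp, zero_mul]
        intro h'
        simp only at hs
        exact hn ⟨⟨by simpa using by linarith [h'.1, hs.1], by simpa using by linarith [h'.2, hs.2]⟩, hs⟩
      rw [MeasureTheory.IntegrableOn, ← MeasureTheory.Measure.prod_restrict,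
        MeasureTheory.Measure.restrict_univ] at h4
      exact h4
    beta_reduce
    rw [← hG, ft, boxFT]
    simp only [intervalIntegral.integral_of_le ha.le, mul_assoc]
    rw [MeasureTheory.integral_const_mul]
    congr 1
    simp only [← MeasureTheory.integral_mul_const]
    simp only [mul_assoc] at hint
    rw [MeasureTheory.integral_integral_swap hint]
    refine MeasureTheory.integral_congr_ae (Filter.Eventually.of_forall fun s => ?_)
    simp only
    rw [← MeasureTheory.integral_add_right_eq_self _ s, ft, ← MeasureTheory.integral_const_mul]
    congr 1
    ext t
    rw [add_sub_cancel_right, mul_left_comm (Complex.exp _), ← Complex.exp_add]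
    congr 2
    push_cast
    ring

lemma mul_boxFT (a : ℝ) (z : ℂ) :
    Complex.I * z * boxFT a z = (a : ℂ)⁻¹ * (1 - Complex.exp (-(Complex.I * z * a))) := by
  by_cases hz : z = 0
  · simp [hz]
  · have h := integral_exp_mul_complex (a := 0) (b := a) (c := -(Complex.I * z))
      (by simp [hz])
    rw [boxFT]
    simp only [neg_mul] at h
    rw [h]
    have : Complex.I ≠ 0 := Complex.I_ne_zero
    field_simp
    simp only [Complex.ofReal_zero, mul_zero, neg_zero, Complex.exp_zero]
    ring

/-- By `mul_boxFT`, multiplying by `z * boxFT a z` replaces `f` by a difference quotient `(f(t) -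
f(t - a)) / (i a)`, whence `2 / a`; the summand `i b` is paid for by `mul_box`. -/
lemma IsTransform.mul_linear_box {τ c a b : ℝ} {G : ℂ → ℂ} (h : IsTransform τ c G) (ha : 0 < a)
    (hb : 0 ≤ b) :
    IsTransform (τ + a) ((2 / a + b) * c)
      (fun z => (z + Complex.I * b) * (boxFT a z * G z)) := by
  have h1 := (h.mul_box ha).const_mul (Complex.I * b)
  have h0 := h.nonneg
  have h2 : IsTransform (τ + a) (2 / a * c) (fun z => z * (boxFT a z * G z)) := by
    obtain ⟨f, hf, hG⟩ := h
    have hshift : IsWindow (τ + a) c fun t => f (t - a) := by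
      refine ⟨hf.meas.comp (measurable_id.sub_const a), fun t => hf.bound _, fun t ht => hf.supp _ ?_⟩
      exact fun h' => ht ⟨by linarith [h'.1], by linarith [h'.2]⟩
    have hA : IsTransform (τ + a) c G := ⟨f, hf.mono (by linarith) le_rfl, hG⟩
    have hB : IsTransform (τ + a) c (fun z => Complex.exp (-(Complex.I * z * a)) * G z) := by
      refine ⟨_, hshift, fun z => ?_⟩
      beta_reduce
      rw [← hG, ft, ft, ← MeasureTheory.integral_add_right_eq_self _ a,
        ← MeasureTheory.integral_const_mul]
      congr 1
      ext t
      rw [add_sub_cancel_right, mul_left_comm (Complex.exp _), ← Complex.exp_add]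
      congr 2
      push_cast
      ring
    have hC := (hA.add (hB.const_mul (-1))).const_mul ((Complex.I * a)⁻¹)
    convert hC using 1
    · simp [abs_of_pos ha]
      ring
    · ext z
      have h3 := mul_boxFT a z
      have hI : Complex.I ≠ 0 := Complex.I_ne_zero
      have ha' : (a : ℂ) ≠ 0 := by exact_mod_cast ha.ne'
      have h4 : z * boxFT a z = Complex.I⁻¹ *
          ((a : ℂ)⁻¹ * (1 - Complex.exp (-(Complex.I * z * a)))) := by
        rw [← h3]; field_simp
      rw [← mul_assoc, h4]
      field_simp
      ring
  convert h2.add h1 using 1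
  · simp [abs_of_nonneg hb]
    ring
  · ext z
    ring

/-- The first `k` boxes each absorb one linear factor; the other `m` only lengthen the support. All
powers up to the number of boxes can thus share the same multiplier. -/
lemma IsTransform.mul_pow_prod_box {τ c b : ℝ} {G : ℂ → ℂ} (h : IsTransform τ c G) {a : ℕ → ℝ}
    (ha : ∀ j, 0 < a j) (hb : 0 ≤ b) (k m : ℕ) :
    IsTransform (τ + ∑ j ∈ Finset.range (k + m), a j) ((∏ j ∈ Finset.range k, (2 / a j + b)) * c)
      (fun z => (z + Complex.I * b) ^ k * ((∏ j ∈ Finset.range (k + m), boxFT (a j) z) * G z)) := by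
  induction m with
  | zero =>
    induction k with
    | zero => simpa using h
    | succ k ih =>
      convert ih.mul_linear_box (ha k) hb using 1
      · simp [Finset.sum_range_succ]; ring
      · simp [Finset.prod_range_succ]; ring
      · ext z
        simp [Finset.prod_range_succ, pow_succ]
        ring
  | succ m ih =>
    convert ih.mul_box (ha (k + m)) using 1
    · rw [← add_assoc, Finset.sum_range_succ]; ring
    · ext z
      rw [← add_assoc, Finset.prod_range_succ]
      ring

lemma IsWindow.hasDerivAt_ft {τ c : ℝ} {f : ℝ → ℂ} (h : IsWindow τ c f) (z : ℂ) :
    HasDerivAt (ft f)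
      (-(Complex.I * ∫ t : ℝ, f t * (t * Complex.exp (-(Complex.I * z * t))))) z := by
  have hc := h.nonneg
  have hbd : ∀ t ∈ Set.Icc 0 τ, ∀ w ∈ Metric.ball z 1,
      ‖Complex.exp (-(Complex.I * w * t))‖ ≤ Real.exp ((‖z‖ + 1) * t) := by
    intro t ht w hw
    rw [Complex.norm_exp]
    refine Real.exp_le_exp.2 ?_
    refine (Complex.re_le_norm _).trans ?_
    rw [norm_neg, norm_mul, norm_mul, Complex.norm_I, one_mul, Complex.norm_real,
      Real.norm_of_nonneg ht.1]
    have : ‖w‖ ≤ ‖z‖ + 1 := by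
      have h1 : ‖w - z‖ < 1 := by simpa [dist_eq_norm] using hw
      have h2 := norm_add_le z (w - z)
      rw [add_sub_cancel] at h2
      linarith
    exact mul_le_mul_of_nonneg_right this ht.1
  have key := hasDerivAt_integral_of_dominated_loc_of_deriv_le (μ := MeasureTheory.volume)
    (F := fun (w : ℂ) (t : ℝ) => f t * Complex.exp (-(Complex.I * w * t)))
    (F' := fun (w : ℂ) (t : ℝ) => f t * (-(Complex.I * t) * Complex.exp (-(Complex.I * w * t))))
    (x₀ := z) (s := Metric.ball z 1)
    (bound := (Set.Icc 0 τ).indicator fun t => c * (t * Real.exp ((‖z‖ + 1) * t)))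
    (Metric.ball_mem_nhds z one_pos)
    (Filter.Eventually.of_forall fun w => (h.integrable_ft w).aestronglyMeasurable)
    (h.integrable_ft z)
    (h.integrable_mul (by fun_prop)).aestronglyMeasurable
    (Filter.Eventually.of_forall fun t w hw => ?_)
    ?_
    (Filter.Eventually.of_forall fun t w _ => ?_)
  · refine key.2.congr_deriv ?_
    rw [← MeasureTheory.integral_const_mul, ← MeasureTheory.integral_neg]
    congr 1
    ext t
    ring
  · by_cases ht : t ∈ Set.Icc 0 τ
    · rw [Set.indicator_of_mem ht, norm_mul, norm_mul, norm_neg, norm_mul, Complex.norm_I, one_mul,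
        Complex.norm_real, Real.norm_of_nonneg ht.1]
      have h1 := hbd t ht w hw
      have h2 := ht.1
      have h3 := h.bound t
      gcongr
    · simp [ht, h.supp t ht]
  · rw [MeasureTheory.integrable_indicator_iff measurableSet_Icc]
    exact Continuous.integrableOn_Icc (by fun_prop)
  · have h1 : HasDerivAt (fun w : ℂ => -(Complex.I * w * t)) (-(Complex.I * 1 * t)) w :=
      (((hasDerivAt_id w).const_mul Complex.I).mul_const (t : ℂ)).neg
    refine (h1.cexp.const_mul (f t)).congr_deriv ?_
    ring

lemma IsTransform.differentiable {τ c : ℝ} {G : ℂ → ℂ} (h : IsTransform τ c G) :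
    Differentiable ℂ G := by
  obtain ⟨f, hf, hG⟩ := h
  have : ft f = G := funext hG
  exact this ▸ fun z => (hf.hasDerivAt_ft z).differentiableAt

/-! ### Growth of canonical products over sparse sets. -/

/-- The right side is `∫ x ^ (-s)` over `[q, q + 1]`, in a form that telescopes. -/
lemma rpow_neg_le_sub {s q : ℝ} (hs : 1 < s) (hq : 0 < q) :
    (q + 1) ^ (-s) ≤ (q ^ (1 - s) - (q + 1) ^ (1 - s)) / (s - 1) := by
  have hs' : 0 < s - 1 := by linarith
  have hq1 : 0 < q + 1 := by linarith
  have h1 : q ^ (1 - s) = (q + 1) ^ (1 - s) * ((q + 1) / q) ^ (s - 1) := by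
    rw [Real.div_rpow hq1.le hq.le, ← mul_div_assoc, ← Real.rpow_add hq1,
      show 1 - s + (s - 1) = 0 by ring, Real.rpow_zero, one_div, ← Real.rpow_neg hq.le]
    congr 1
    ring
  have h2 : 1 + (s - 1) / (q + 1) ≤ ((q + 1) / q) ^ (s - 1) := by
    have h3 := Real.one_sub_inv_le_log_of_pos (x := (q + 1) / q) (by positivity)
    have h4 : 1 - ((q + 1) / q)⁻¹ = 1 / (q + 1) := by field_simp; ring
    rw [h4] at h3
    rw [Real.rpow_def_of_pos (by positivity)]
    have h5 := Real.add_one_le_exp (Real.log ((q + 1) / q) * (s - 1))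
    have h6 := mul_le_mul_of_nonneg_right h3 hs'.le
    have h7 : 1 / (q + 1) * (s - 1) = (s - 1) / (q + 1) := by ring
    linarith
  have h8 : (q + 1) ^ (-s) = (q + 1) ^ (1 - s) / (q + 1) := by
    rw [show -s = (1 - s) - 1 by ring, Real.rpow_sub_one hq1.ne']
  rw [le_div_iff₀ hs', h1, h8]
  have h9 := mul_le_mul_of_nonneg_left h2 (Real.rpow_nonneg hq1.le (1 - s))
  have h10 : (q + 1) ^ (1 - s) / (q + 1) * (s - 1) =
    (q + 1) ^ (1 - s) * ((s - 1) / (q + 1)) := by ring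
  linarith

lemma sum_rpow_neg_le {s q : ℝ} (hs : 1 < s) (hq : 0 < q) (n : ℕ) :
    ∑ i ∈ Finset.range n, (q + i) ^ (-s) ≤ q ^ (-s) + q ^ (1 - s) / (s - 1) := by
  have hs' : 0 < s - 1 := by linarith
  have key : ∀ n : ℕ, ∑ i ∈ Finset.range (n + 1), (q + i) ^ (-s) ≤
      q ^ (-s) + (q ^ (1 - s) - (q + n) ^ (1 - s)) / (s - 1) := by
    intro n
    induction n with
    | zero => simp
    | succ n ih =>
      rw [Finset.sum_range_succ]
      have h := rpow_neg_le_sub hs (q := q + n) (by positivity)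
      push_cast
      rw [← add_assoc]
      have : (q ^ (1 - s) - (q + n + 1) ^ (1 - s)) / (s - 1) =
        (q ^ (1 - s) - (q + n) ^ (1 - s)) / (s - 1) +
        ((q + n) ^ (1 - s) - (q + n + 1) ^ (1 - s)) / (s - 1) := by ring
      linarith
  refine (Finset.sum_le_sum_of_subset_of_nonneg (Finset.range_subset_range.2 n.le_succ)
    fun i _ _ => by positivity).trans ((key n).trans ?_)
  gcongr
  linarith [Real.rpow_nonneg (show 0 ≤ q + n by positivity) (1 - s)]

/-- Split at `J = ⌊X⌋`. For `j < J` the power is at least `1`, so these factors contribute at most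
`((2X)^J / J!)^s ≤ e^{2Xs}`. For the rest, `1 + u ≤ e^u`, and the tail sum of `(X / (j + 1)) ^ s` is
`O(1 + X)`. -/
lemma prod_one_add_rpow_le {s X : ℝ} (hs : 1 < s) (hX : 0 ≤ X) (n : ℕ) :
    ∏ j ∈ Finset.range n, (1 + (X / (j + 1)) ^ s) ≤
      Real.exp ((2 * s + 1 + 1 / (s - 1)) * (1 + X)) := by
  have hs' : 0 < s - 1 := by linarith
  set J := ⌊X⌋₊
  have hJ1 : (J : ℝ) ≤ X := Nat.floor_le hX
  have hJ2 : X < J + 1 := Nat.lt_floor_add_one X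
  have h0 : ∀ j : ℕ, 0 ≤ (X / (j + 1)) ^ s := fun j => by positivity
  have h1 : ∏ j ∈ Finset.range n, (1 + (X / (j + 1)) ^ s) ≤
      ∏ j ∈ Finset.range (J + n), (1 + (X / (j + 1)) ^ s) :=
    Finset.prod_le_prod_of_subset_of_one_le
      (Finset.range_subset_range.2 (Nat.le_add_left n J))
      (fun j _ => by linarith [h0 j]) (fun j _ _ => by linarith [h0 j])
  have h2 : ∏ j ∈ Finset.range J, (1 + (X / (j + 1)) ^ s) ≤ Real.exp (2 * X) ^ s := by
    have h3 : ∏ j ∈ Finset.range J, (1 + (X / (j + 1)) ^ s) ≤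
        ∏ j ∈ Finset.range J, (2 * X / ((j : ℝ) + 1)) ^ s := by
      refine Finset.prod_le_prod (fun j _ => by linarith [h0 j]) fun j hj => ?_
      have hj' : (j : ℝ) + 1 ≤ J := by exact_mod_cast Finset.mem_range.1 hj
      have h4 : 1 ≤ X / ((j : ℝ) + 1) := by
        rw [le_div_iff₀ (by positivity)]
        linarith
      have h5 : 1 ≤ (X / ((j : ℝ) + 1)) ^ s := Real.one_le_rpow h4 (by linarith)
      have h6 : (2 : ℝ) ≤ 2 ^ s := by
        simpa using Real.rpow_le_rpow_of_exponent_le (x := 2) (by norm_num) hs.le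
      rw [mul_div_assoc, Real.mul_rpow (by norm_num) (by positivity)]
      nlinarith
    refine h3.trans ?_
    rw [Real.finsetProd_rpow _ _ fun j _ => by positivity]
    refine Real.rpow_le_rpow (Finset.prod_nonneg fun j _ => by positivity) ?_ (by linarith)
    rw [Finset.prod_div_distrib, Finset.prod_const, Finset.card_range]
    have h7 : ∏ j ∈ Finset.range J, ((j : ℝ) + 1) = (J.factorial : ℝ) := by
      rw [← Finset.prod_range_add_one_eq_factorial]
      push_cast
      rfl
    rw [h7]
    exact Real.pow_div_factorial_le_exp _ (by positivity) _
  have h8 : ∏ i ∈ Finset.range n, (1 + (X / ((J + i : ℕ) + 1)) ^ s) ≤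
      Real.exp (1 + X / (s - 1)) := by
    have h9 : ∏ i ∈ Finset.range n, (1 + (X / ((J + i : ℕ) + 1)) ^ s) ≤
        ∏ i ∈ Finset.range n, Real.exp (X ^ s * ((J : ℝ) + 1 + i) ^ (-s)) := by
      refine Finset.prod_le_prod (fun j _ => by linarith [h0 (J + j)]) fun i _ => ?_
      have : X ^ s * ((J : ℝ) + 1 + i) ^ (-s) = (X / ((J + i : ℕ) + 1)) ^ s := by
        rw [Real.div_rpow hX (by positivity), Real.rpow_neg (by positivity), div_eq_mul_inv]
        push_cast
        congr 3
        ring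
      rw [this, add_comm]
      exact Real.add_one_le_exp _
    refine h9.trans ?_
    rw [← Real.exp_sum, ← Finset.mul_sum]
    refine Real.exp_le_exp.2 ?_
    have hq : (0 : ℝ) < J + 1 := by positivity
    have h10 := mul_le_mul_of_nonneg_left (sum_rpow_neg_le hs hq n) (Real.rpow_nonneg hX s)
    refine h10.trans ?_
    have h11 : X ^ s ≤ ((J : ℝ) + 1) ^ s := Real.rpow_le_rpow hX hJ2.le (by linarith)
    have h12 : X ^ (s - 1) ≤ ((J : ℝ) + 1) ^ (s - 1) := Real.rpow_le_rpow hX hJ2.le (by linarith)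
    have h13 : X ^ s = X * X ^ (s - 1) := by
      conv_lhs => rw [show s = 1 + (s - 1) by ring]
      rw [Real.rpow_add' hX (by linarith), Real.rpow_one]
    have h14 : X ^ s * ((J : ℝ) + 1) ^ (-s) ≤ 1 := by
      rw [Real.rpow_neg hq.le, ← div_eq_mul_inv]
      exact div_le_one_of_le₀ h11 (by positivity)
    have h15 : X ^ s * ((J : ℝ) + 1) ^ (1 - s) ≤ X := by
      rw [h13, show 1 - s = -(s - 1) by ring, Real.rpow_neg hq.le, mul_assoc, ← div_eq_mul_inv]
      exact mul_le_of_le_one_right hX (div_le_one_of_le₀ h12 (by positivity))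
    rw [mul_add, ← mul_div_assoc]
    gcongr
  refine h1.trans ?_
  rw [Finset.prod_range_add]
  refine (mul_le_mul h2 h8 (Finset.prod_nonneg fun i _ => by linarith [h0 (J + i)])
    (by positivity)).trans ?_
  rw [← Real.exp_mul, ← Real.exp_add]
  refine Real.exp_le_exp.2 ?_
  have h16 : 0 < 1 / (s - 1) := by positivity
  have h17 : X / (s - 1) = 1 / (s - 1) * X := by ring
  rw [h17]
  nlinarith

/-- A finite family of positive radii with at most `B r ^ κ` members up to `r` is comparable with
`j ↦ (j / B) ^ (1 / κ)`. -/
lemma prod_one_add_div_le_of_card_le {ι : Type*} {κ B x : ℝ} (hκ : 0 < κ) (hB : 0 < B)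
    (hx : 0 ≤ x) (d : ι → ℝ) (F : Finset ι) (hd : ∀ i ∈ F, 0 < d i)
    (hF : ∀ S ⊆ F, ∀ r, 0 ≤ r → (∀ i ∈ S, d i ≤ r) → (S.card : ℝ) ≤ B * r ^ κ) :
    ∏ i ∈ F, (1 + x / d i) ≤
      ∏ j ∈ Finset.range F.card, (1 + (B * x ^ κ / (j + 1)) ^ (1 / κ)) := by
  classical
  induction F using Finset.induction_on_max_value d with
  | empty => simp
  | insert a S ha hmax ih =>
    have hda := hd a (Finset.mem_insert_self _ _)
    have ih' := ih (fun i hi => hd i (Finset.mem_insert_of_mem hi))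
      fun S' hS' => hF S' (hS'.trans (Finset.subset_insert _ _))
    rw [Finset.prod_insert ha, Finset.card_insert_of_notMem ha, Finset.prod_range_succ, mul_comm]
    -- `a` has the largest radius, so all `S.card + 1` members lie within `d a`; this bounds its
    -- factor by the one of index `S.card`.
    have hcard := hF (insert a S) le_rfl (d a) hda.le fun i hi => by
      rcases Finset.mem_insert.1 hi with rfl | hi
      · exact le_rfl
      · exact hmax i hi
    rw [Finset.card_insert_of_notMem ha] at hcard
    push_cast at hcard
    refine mul_le_mul ih' ?_ (by positivity) (Finset.prod_nonneg fun j _ => by positivity)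
    gcongr
    have h1 : x / d a = ((x / d a) ^ κ) ^ (1 / κ) := by
      rw [← Real.rpow_mul (by positivity), mul_one_div_cancel hκ.ne', Real.rpow_one]
    rw [h1]
    refine Real.rpow_le_rpow (by positivity) ?_ (by positivity)
    rw [Real.div_rpow hx hda.le, div_le_div_iff₀ (by positivity) (by positivity)]
    calc x ^ κ * (S.card + 1) ≤ x ^ κ * (B * d a ^ κ) := by gcongr
      _ = _ := by ring

/-! ### Elementary symmetric functions against the cost of powers. -/

/-- A Cauchy estimate: `r ^ k` times the `k`-th elementary symmetric function is one of the
nonnegative terms of `∏ (1 + r * y i)`. The choice `r = k ^ (1 / κ)` makes `r ^ κ = k`. -/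
lemma sum_powersetCard_prod_le {ι : Type*} {κ A : ℝ} (hκ : 0 < κ) (D : Finset ι)
    (y : ι → ℝ) (hy : ∀ i ∈ D, 0 ≤ y i)
    (hD : ∀ r, 0 ≤ r → ∏ i ∈ D, (1 + r * y i) ≤ Real.exp (A * (1 + r ^ κ))) (k : ℕ) :
    ∑ S ∈ D.powersetCard k, ∏ i ∈ S, y i ≤
      Real.exp (A * (1 + k)) / ((k : ℝ) ^ k) ^ (1 / κ) := by
  have hpow : (0 : ℝ) < (k : ℝ) ^ k := by
    rcases Nat.eq_zero_or_pos k with rfl | hk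
    · simp
    · positivity
  rw [le_div_iff₀ (by positivity)]
  set r : ℝ := (k : ℝ) ^ (1 / κ) with hr
  have hr0 : 0 ≤ r := by positivity
  have hrκ : r ^ κ = k := by
    rw [hr, ← Real.rpow_mul (by positivity), one_div_mul_cancel hκ.ne', Real.rpow_one]
  have hrk : ((k : ℝ) ^ k) ^ (1 / κ) = r ^ k := by
    rw [hr, ← Real.rpow_natCast, ← Real.rpow_natCast, ← Real.rpow_mul (by positivity),
      ← Real.rpow_mul (by positivity), mul_comm]
  have h := hD r hr0
  rw [hrκ, Finset.prod_one_add] at h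
  refine le_trans ?_ h
  rw [hrk, Finset.sum_mul]
  refine le_trans (le_of_eq ?_) (Finset.sum_le_sum_of_subset_of_nonneg
    (s := D.powersetCard k) (f := fun S => ∏ i ∈ S, r * y i) (fun S hS => ?_) fun S hS _ => ?_)
  · refine Finset.sum_congr rfl fun S hS => ?_
    rw [Finset.prod_mul_distrib, Finset.prod_const, (Finset.mem_powersetCard.1 hS).2, mul_comm]
  · exact Finset.mem_powerset.2 (Finset.mem_powersetCard.1 hS).1
  · exact Finset.prod_nonneg fun i hi =>
      mul_nonneg hr0 (hy i (Finset.mem_powerset.1 hS hi))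

/-- From `(1 + N / k) ^ k ≤ e ^ N`: shifting the box index by `N` costs a factor independent of `k`.
-/
lemma natCast_add_pow_self_le (k N : ℕ) : ((k : ℝ) + N) ^ k ≤ Real.exp N * (k : ℝ) ^ k := by
  rcases Nat.eq_zero_or_pos k with rfl | hk
  · simp
  · have hk' : (0 : ℝ) < k := by exact_mod_cast hk
    have h1 : (k : ℝ) + N = (N / k + 1) * k := by field_simp; ring
    have h2 : ((N : ℝ) / k + 1) ^ k ≤ Real.exp (N / k) ^ k :=
      pow_le_pow_left₀ (by positivity) (Real.add_one_le_exp _) _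
    rw [← Real.exp_nat_mul, mul_div_cancel₀ _ hk'.ne'] at h2
    rw [h1, mul_pow]
    gcongr

/-- The weights `W k` grow slower than the elementary symmetric functions of `y` decay. -/
lemma sum_powerset_prod_mul_le {ι : Type*} {κ A P δ : ℝ} {N : ℕ} (hκ : 0 < κ)
    (hδ : δ = 4 * Real.exp A) (hP : 0 ≤ P) (D : Finset ι)
    (y : ι → ℝ) (hy : ∀ i ∈ D, 0 ≤ y i)
    (hD : ∀ r, 0 ≤ r → ∏ i ∈ D, (1 + r * y i) ≤ Real.exp (A * (1 + r ^ κ)))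
    (W : ℕ → ℝ) (hW0 : ∀ k, 0 ≤ W k)
    (hW : ∀ k, W k ≤ (2 / δ) ^ k * (((k : ℝ) + N) ^ k) ^ (1 / κ) * P) :
    ∑ S ∈ D.powerset, (∏ i ∈ S, y i) * W S.card ≤
      2 * (Real.exp A * Real.exp N ^ (1 / κ)) * P := by
  have hδ0 : 0 < δ := by rw [hδ]; positivity
  have hterm : ∀ k : ℕ, (∑ S ∈ D.powersetCard k, ∏ i ∈ S, y i) * W k ≤
      Real.exp A * Real.exp N ^ (1 / κ) * P * (1 / 2) ^ k := by
    intro k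
    have hpow : (0 : ℝ) < (k : ℝ) ^ k := by
      rcases Nat.eq_zero_or_pos k with rfl | hk
      · simp
      · positivity
    have h1 : W k ≤ (2 / δ) ^ k * (Real.exp N ^ (1 / κ) * ((k : ℝ) ^ k) ^ (1 / κ)) * P := by
      refine (hW k).trans ?_
      rw [← Real.mul_rpow (by positivity) (by positivity)]
      gcongr
      exact natCast_add_pow_self_le k N
    refine (mul_le_mul (sum_powersetCard_prod_le hκ D y hy hD k) h1 (hW0 k)
      (by positivity)).trans (le_of_eq ?_)
    -- The value `δ = 4 e ^ A` is chosen to make the ratio `e ^ A * (2 / δ)` equal to `1 / 2`.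
    have h2 : Real.exp (A * (1 + k)) * (2 / δ) ^ k = Real.exp A * (1 / 2) ^ k := by
      rw [mul_add, mul_one, Real.exp_add, mul_comm A, Real.exp_nat_mul, mul_assoc, ← mul_pow, hδ]
      congr 2
      field_simp
      norm_num
    have h3 : ((k : ℝ) ^ k) ^ (1 / κ) ≠ 0 := by positivity
    calc _ = (Real.exp (A * (1 + k)) * (2 / δ) ^ k) * Real.exp N ^ (1 / κ) * P := by
          field_simp
      _ = _ := by rw [h2]; ring
  rw [Finset.sum_powerset]
  have h4 : ∀ j ∈ Finset.range (D.card + 1),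
      ∑ S ∈ D.powersetCard j, (∏ i ∈ S, y i) * W S.card ≤
        Real.exp A * Real.exp N ^ (1 / κ) * P * (1 / 2) ^ j := by
    intro j _
    refine le_trans (le_of_eq ?_) (hterm j)
    rw [Finset.sum_mul]
    exact Finset.sum_congr rfl fun S hS => by rw [(Finset.mem_powersetCard.1 hS).2]
  refine (Finset.sum_le_sum h4).trans ?_
  rw [← Finset.mul_sum]
  have h5 : ∑ j ∈ Finset.range (D.card + 1), (1 / 2 : ℝ) ^ j ≤ 2 := by
    refine (Summable.sum_le_tsum _ (fun _ _ => by positivity) summable_geometric_two).trans ?_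
    rw [tsum_geometric_two]
  calc _ ≤ Real.exp A * Real.exp N ^ (1 / κ) * P * 2 := by gcongr
    _ = _ := by ring

/-! ### Size of products of boxes at depth `b`. -/

/-- For `b > 0` the value is `(1 - e^{-ab}) / (ab)`, and `e^{ab} ≥ 1 + ab`. -/
lemma one_le_mul_norm_boxFT {a b : ℝ} (ha : 0 < a) (hb : 0 ≤ b) :
    1 ≤ (1 + a * b) * ‖boxFT a (-(Complex.I * b))‖ := by
  rcases hb.eq_or_lt with rfl | hb
  · have ha' : (a : ℂ) ≠ 0 := by exact_mod_cast ha.ne'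
    simp [boxFT, ha']
  · have h := mul_boxFT a (-(Complex.I * b))
    have hI : Complex.I * -(Complex.I * (b : ℂ)) = b := by
      rw [mul_neg, ← mul_assoc, Complex.I_mul_I]; ring
    rw [hI] at h
    have h1 : ‖(a : ℂ)⁻¹ * (1 - Complex.exp (-(b * a)))‖ = a⁻¹ * (1 - Real.exp (-(b * a))) := by
      have : (a : ℂ)⁻¹ * (1 - Complex.exp (-(b * a))) =
          ((a⁻¹ * (1 - Real.exp (-(b * a))) : ℝ) : ℂ) := by push_cast; rfl
      rw [this, Complex.norm_real, Real.norm_of_nonneg]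
      have : Real.exp (-(b * a)) ≤ 1 := Real.exp_le_one_iff.2 (by nlinarith)
      have h2 : 0 ≤ 1 - Real.exp (-(b * a)) := by linarith
      positivity
    have h2 := congrArg norm h
    rw [h1, norm_mul, Complex.norm_real, Real.norm_of_nonneg hb.le] at h2
    have h3 : Real.exp (-(b * a)) * (1 + b * a) ≤ 1 := by
      rw [Real.exp_neg, inv_mul_le_iff₀ (Real.exp_pos _)]
      linarith [Real.add_one_le_exp (b * a)]
    have h4 : b * a * ‖boxFT a (-(Complex.I * b))‖ = 1 - Real.exp (-(b * a)) := by
      rw [mul_right_comm, h2]; field_simp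
    have h5 : 0 < b * a := by positivity
    refine le_of_mul_le_mul_left ?_ h5
    have h6 : b * a * ((1 + a * b) * ‖boxFT a (-(Complex.I * b))‖) =
        (1 + b * a) * (1 - Real.exp (-(b * a))) := by rw [← h4]; ring
    rw [h6]
    linarith

lemma one_add_mul_le_mul {X t : ℝ} (hX : 0 ≤ X) (ht : 0 ≤ t) : 1 + X * t ≤ (1 + X) * (1 + t) := by
  nlinarith

/-- `a j * b ≤ (X / (j + 1)) ^ (1 / κ)` with `X = δ ^ κ * b ^ κ`; this is the source of the exponent
`κ` on `Im (λ m)` in the final bound. -/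
lemma prod_one_add_mul_box_le {κ δ b : ℝ} (hκ₀ : 0 < κ) (hκ₁ : κ < 1) (hδ : 0 ≤ δ) (hb : 0 ≤ b)
    {a : ℕ → ℝ} (ha : ∀ j, 0 ≤ a j) (haδ : ∀ j : ℕ, a j ≤ δ * ((j : ℝ) + 1) ^ (-(1 / κ))) (n : ℕ) :
    ∏ j ∈ Finset.range n, (1 + a j * b) ≤
      Real.exp ((2 * (1 / κ) + 1 + 1 / (1 / κ - 1)) * (1 + δ ^ κ) * (1 + b ^ κ)) := by
  have hs : 1 < 1 / κ := by rw [lt_div_iff₀ hκ₀]; linarith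
  have hs' : 0 < 1 / (1 / κ - 1) := by
    have : 0 < 1 / κ - 1 := by linarith
    positivity
  have hX : 0 ≤ δ ^ κ * b ^ κ := by positivity
  have hXs : (δ ^ κ * b ^ κ) ^ (1 / κ) = δ * b := by
    rw [← Real.mul_rpow hδ hb, ← Real.rpow_mul (by positivity), mul_one_div_cancel hκ₀.ne',
      Real.rpow_one]
  refine (Finset.prod_le_prod (fun j _ => ?_) fun j _ => ?_).trans
    ((prod_one_add_rpow_le hs hX n).trans (Real.exp_le_exp.2 ?_))
  · have := ha j; positivity
  · rw [Real.div_rpow hX (by positivity), hXs]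
    have h1 := mul_le_mul_of_nonneg_right (haδ j) hb
    rw [Real.rpow_neg (by positivity)] at h1
    have h2 : δ * (((j : ℝ) + 1) ^ (1 / κ))⁻¹ * b = δ * b / ((j : ℝ) + 1) ^ (1 / κ) := by
      field_simp
    linarith
  · rw [mul_assoc]
    refine mul_le_mul_of_nonneg_left (one_add_mul_le_mul (by positivity) (by positivity)) ?_
    positivity

/-- Since `δ` is dictated by the density, the boxes are fitted into a short interval by discarding
the first `N` lengths rather than by scaling. -/
lemma exists_sum_rpow_le {s ε : ℝ} (hs : 1 < s) (hε : 0 < ε) :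
    ∃ N : ℕ, ∀ n : ℕ, ∑ j ∈ Finset.range n, ((j : ℝ) + 1 + N) ^ (-s) ≤ ε := by
  have h1 : Filter.Tendsto (fun q : ℝ => q ^ (-s) + q ^ (-(s - 1)) / (s - 1)) Filter.atTop
      (nhds (0 + 0 / (s - 1))) :=
    (tendsto_rpow_neg_atTop (by linarith)).add
      ((tendsto_rpow_neg_atTop (by linarith)).div_const _)
  rw [zero_div, add_zero] at h1
  have h2 := (h1.comp tendsto_natCast_atTop_atTop).eventually (eventually_le_nhds hε)
  obtain ⟨N, hN, hN1⟩ := (h2.and (Filter.eventually_ge_atTop 1)).exists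
  have hN0 : (0 : ℝ) < N := by exact_mod_cast hN1
  refine ⟨N, fun n => ?_⟩
  refine le_trans ?_ ((sum_rpow_neg_le hs hN0 n).trans ?_)
  · refine Finset.sum_le_sum fun j _ => ?_
    exact Real.rpow_le_rpow_of_nonpos (by positivity) (by linarith) (by linarith)
  · rw [show 1 - s = -(s - 1) by ring]
    exact hN

/-! ### Construction of a transform with prescribed double zeros. -/

lemma prod_one_sub_div {ι : Type*} (D : Finset ι) (μ : ι → ℂ) (w : ℂ) :
    ∏ i ∈ D, (1 - w / μ i) = ∑ S ∈ D.powerset, (∏ i ∈ S, -(μ i)⁻¹) * w ^ S.card := by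
  have : ∀ i, 1 - w / μ i = 1 + -(μ i)⁻¹ * w := fun i => by ring
  simp only [this, Finset.prod_one_add, Finset.prod_mul_distrib, Finset.prod_const]

/-- A product vanishing to second order at finitely many points of sparse counting function,
multiplied by an entire function that makes it a transform with controlled norm. -/
lemma exists_transform_of_card_le {κ T B : ℝ} (hκ₀ : 0 < κ) (hκ₁ : κ < 1) (hT : 0 < T)
    (hB : 0 < B) :
    ∃ C C' : ℝ, 0 < C ∧ 0 < C' ∧ ∀ (ι : Type) (F : Finset ι) (μ : ι → ℂ) (b : ℝ), 0 ≤ b →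
      (∀ S ⊆ F, ∀ r, 0 ≤ r → (∀ i ∈ S, ‖μ i‖ ≤ r) → (S.card : ℝ) ≤ B * r ^ κ) →
      ∃ R : ℂ → ℂ, Differentiable ℂ R ∧ R (-(Complex.I * b)) = 1 ∧
        IsTransform T (C * Real.exp (C' * b ^ κ))
          (fun z => (∏ i ∈ F, (1 - (z + Complex.I * b) / μ i) ^ 2) * R z) ∧
        IsTransform T (C * Real.exp (C' * b ^ κ))
          (fun z => (z + Complex.I * b) *
            ((∏ i ∈ F, (1 - (z + Complex.I * b) / μ i) ^ 2) * R z)) := by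
  have hs : 1 < 1 / κ := by rw [lt_div_iff₀ hκ₀]; linarith
  have hs' : 0 < 1 / κ - 1 := by linarith
  set A₀ : ℝ := 2 * (1 / κ) + 1 + 1 / (1 / κ - 1) with hA₀
  have hA₀pos : 0 < A₀ := by positivity
  -- The factor `2` accounts for the double zeros.
  set A : ℝ := 2 * (A₀ * (1 + B)) with hA
  set δ : ℝ := 4 * Real.exp A with hδ
  have hδ0 : 0 < δ := by positivity
  obtain ⟨N, hN⟩ := exists_sum_rpow_le hs (ε := T / 2 / δ) (by positivity)
  -- Support budget: `T / 2` for the boxes `a j`, `τ` for the box that starts the product, and `τ`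
  -- for one more box reserved for an extra linear factor.
  set τ : ℝ := T / 4 with hτ
  have hτ0 : 0 < τ := by positivity
  set A₂ : ℝ := A₀ * (1 + δ ^ κ) with hA₂
  have hA₂pos : 0 < A₂ := by positivity
  set A₃ : ℝ := A₀ * (1 + τ ^ κ) with hA₃
  have hA₃pos : 0 < A₃ := by positivity
  set Q : ℝ := 2 * (Real.exp A * Real.exp N ^ (1 / κ)) with hQ
  have hQ0 : 0 < Q := by positivity
  -- The exponent is that of `E ^ 3 * P ^ 2`: normalization costs `E ^ 2 * P`, the extra linear
  -- factor `E`, and the weights `P`.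
  refine ⟨(2 + τ) / τ * Q * τ⁻¹ * Real.exp (3 * A₃ + 2 * A₂), 3 * A₃ + 2 * A₂,
    by positivity, by positivity, ?_⟩
  intro ι F μ b hb hF
  set a : ℕ → ℝ := fun j => δ * ((j : ℝ) + 1 + N) ^ (-(1 / κ)) with ha
  have ha0 : ∀ j, 0 < a j := fun j => by positivity
  have haδ : ∀ j : ℕ, a j ≤ δ * ((j : ℝ) + 1) ^ (-(1 / κ)) := fun j =>
    mul_le_mul_of_nonneg_left
      (Real.rpow_le_rpow_of_nonpos (by positivity) (by linarith [N.cast_nonneg (α := ℝ)])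
        (by linarith)) hδ0.le
  have hasum : ∀ n : ℕ, ∑ j ∈ Finset.range n, a j ≤ T / 2 := fun n => by
    rw [ha, ← Finset.mul_sum]
    have := mul_le_mul_of_nonneg_left (hN n) hδ0.le
    rwa [mul_div_cancel₀ _ hδ0.ne'] at this
  set P : ℝ := Real.exp (A₂ * (1 + b ^ κ)) with hP
  have hPprod : ∀ n : ℕ, ∏ j ∈ Finset.range n, (1 + a j * b) ≤ P := fun n =>
    prod_one_add_mul_box_le hκ₀ hκ₁ hδ0.le hb (fun j => (ha0 j).le) haδ n
  set E : ℝ := Real.exp (A₃ * (1 + b ^ κ)) with hE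
  -- The one-factor case of the product bound.
  have hE1 : 1 + τ * b ≤ E := by
    have := prod_one_add_mul_box_le hκ₀ hκ₁ hτ0.le hb (a := fun j => τ * ((j : ℝ) + 1) ^ (-(1 / κ)))
      (fun j => by positivity) (fun j => le_rfl) 1
    simpa only [Finset.prod_range_one, Nat.cast_zero, zero_add, Real.one_rpow, mul_one] using this
  have hμ : ∀ i ∈ F, μ i ≠ 0 := by
    intro i hi h0
    -- At radius `0` the counting bound is `B * 0 ^ κ = 0`, which excludes a vanishing node.
    have := hF {i} (by simpa using hi) 0 le_rfl (by simp [h0])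
    rw [Real.zero_rpow hκ₀.ne'] at this
    norm_num at this
  have hgen : ∀ r, 0 ≤ r → ∏ i ∈ F, (1 + r / ‖μ i‖) ≤
      Real.exp (A₀ * (1 + B) * (1 + r ^ κ)) := by
    intro r hr
    refine (prod_one_add_div_le_of_card_le hκ₀ hB hr (fun i => ‖μ i‖) F
      (fun i hi => norm_pos_iff.2 (hμ i hi)) hF).trans
      ((prod_one_add_rpow_le hs (by positivity) _).trans (Real.exp_le_exp.2 ?_))
    rw [mul_assoc]
    exact mul_le_mul_of_nonneg_left (one_add_mul_le_mul hB.le (by positivity)) hA₀pos.le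
  -- every index is counted twice
  set D : Finset (ι × Bool) := F ×ˢ Finset.univ with hD
  have hprod2 : ∀ w : ℂ, ∏ i ∈ F, (1 - w / μ i) ^ 2 = ∏ p ∈ D, (1 - w / μ p.1) := by
    intro w
    rw [hD, Finset.prod_product]
    simp [sq]
  have hDgen : ∀ r, 0 ≤ r → ∏ p ∈ D, (1 + r * ‖μ p.1‖⁻¹) ≤ Real.exp (A * (1 + r ^ κ)) := by
    intro r hr
    have h1 : ∏ p ∈ D, (1 + r * ‖μ p.1‖⁻¹) = (∏ i ∈ F, (1 + r / ‖μ i‖)) ^ 2 := by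
      rw [hD, Finset.prod_product, ← Finset.prod_pow]
      simp [sq, div_eq_mul_inv]
    rw [h1]
    refine (pow_le_pow_left₀ (Finset.prod_nonneg fun i _ => by positivity) (hgen r hr) 2).trans
      (le_of_eq ?_)
    rw [← Real.exp_nat_mul, hA]
    congr 1
    push_cast
    ring
  set W : ℕ → ℝ := fun k => ∏ j ∈ Finset.range k, (2 / a j + b) with hWdef
  have hW0 : ∀ k, 0 ≤ W k := fun k => Finset.prod_nonneg fun j _ => by
    have := ha0 j
    positivity
  have hW : ∀ k, W k ≤ (2 / δ) ^ k * (((k : ℝ) + N) ^ k) ^ (1 / κ) * P := by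
    intro k
    have h1 : W k ≤ ∏ j ∈ Finset.range k,
        (2 / δ * ((k : ℝ) + N) ^ (1 / κ)) * (1 + a j * b) := by
      refine Finset.prod_le_prod (fun j _ => by have := ha0 j; positivity) fun j hj => ?_
      have hj' : (j : ℝ) + 1 ≤ k := by exact_mod_cast Finset.mem_range.1 hj
      have haj := ha0 j
      have h2 : 2 / a j = 2 / δ * ((j : ℝ) + 1 + N) ^ (1 / κ) := by
        simp only [ha]
        rw [Real.rpow_neg (by positivity)]
        field_simp
      have h3 : 2 / a j ≤ 2 / δ * ((k : ℝ) + N) ^ (1 / κ) := by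
        rw [h2]
        gcongr
      calc 2 / a j + b ≤ 2 / a j * (1 + a j * b) := by
            have : 2 / a j * (1 + a j * b) = 2 / a j + 2 * b := by field_simp
            linarith
        _ ≤ _ := by gcongr
    refine h1.trans ?_
    rw [Finset.prod_mul_distrib, Finset.prod_const, Finset.card_range, mul_pow]
    have h4 : (((k : ℝ) + N) ^ (1 / κ)) ^ k = (((k : ℝ) + N) ^ k) ^ (1 / κ) := by
      rw [← Real.rpow_natCast, ← Real.rpow_natCast, ← Real.rpow_mul (by positivity),
        ← Real.rpow_mul (by positivity), mul_comm]
    rw [h4]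
    exact mul_le_mul_of_nonneg_left (hPprod k) (by positivity)
  have hcoef := sum_powerset_prod_mul_le hκ₀ hδ (Real.exp_pos _).le D
    (fun p => ‖μ p.1‖⁻¹) (fun _ _ => by positivity) hDgen W hW0 hW
  set M₀ : ℂ → ℂ := fun z => (∏ j ∈ Finset.range D.card, boxFT (a j) z) * boxFT τ z with hM₀
  have hterm : ∀ S ∈ D.powerset, IsTransform (3 * τ)
      (‖∏ p ∈ S, -(μ p.1)⁻¹‖ * (W S.card * τ⁻¹))
      (fun z => (∏ p ∈ S, -(μ p.1)⁻¹) * ((z + Complex.I * b) ^ S.card * M₀ z)) := by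
    intro S hS
    have hcard := Finset.card_le_card (Finset.mem_powerset.1 hS)
    have h1 := (isTransform_box hτ0).mul_pow_prod_box ha0 hb S.card (D.card - S.card)
    rw [Nat.add_sub_cancel' hcard] at h1
    refine (h1.mono ?_ le_rfl).const_mul _
    have := hasum D.card
    rw [hτ] at *
    linarith
  have hsum := isTransform_sum D.powerset hterm
  have hbase : IsTransform (3 * τ) (Q * P * τ⁻¹)
      (fun z => (∏ i ∈ F, (1 - (z + Complex.I * b) / μ i) ^ 2) * M₀ z) := by
    convert hsum.mono le_rfl (c' := Q * P * τ⁻¹) ?_ using 2 with z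
    · rw [hprod2, prod_one_sub_div, Finset.sum_mul]
      exact Finset.sum_congr rfl fun S _ => by ring
    · refine le_trans (le_of_eq ?_) (mul_le_mul_of_nonneg_right hcoef (inv_nonneg.2 hτ0.le))
      rw [Finset.sum_mul]
      refine Finset.sum_congr rfl fun S _ => ?_
      rw [norm_prod]
      simp only [norm_neg, norm_inv]
      ring
  set z₀ : ℂ := -(Complex.I * b) with hz₀
  -- The second box of length `τ` can absorb one more linear factor, so the same multiplier serves
  -- both required transforms.
  set M : ℂ → ℂ := fun z => boxFT τ z * M₀ z with hM
  have hMlow : 1 ≤ E ^ 2 * P * ‖M z₀‖ := by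
    have h1 := one_le_mul_norm_boxFT hτ0 hb
    have h2 : ∀ n : ℕ, 1 ≤ (∏ j ∈ Finset.range n, (1 + a j * b)) *
        ∏ j ∈ Finset.range n, ‖boxFT (a j) z₀‖ := by
      intro n
      rw [← Finset.prod_mul_distrib]
      exact Finset.prod_const_one.symm.trans_le (Finset.prod_le_prod (fun _ _ => zero_le_one)
        fun j _ => one_le_mul_norm_boxFT (ha0 j) hb)
    rw [← hz₀] at h1
    have h3 : 1 ≤ E * ‖boxFT τ z₀‖ := h1.trans (by gcongr)
    have h4 : 1 ≤ P * ∏ j ∈ Finset.range D.card, ‖boxFT (a j) z₀‖ :=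
      (h2 D.card).trans (mul_le_mul_of_nonneg_right (hPprod _)
        (Finset.prod_nonneg fun _ _ => norm_nonneg _))
    have h5 : E ^ 2 * P * ‖M z₀‖ = (E * ‖boxFT τ z₀‖) * (E * ‖boxFT τ z₀‖) *
        (P * ∏ j ∈ Finset.range D.card, ‖boxFT (a j) z₀‖) := by
      simp only [hM, hM₀, norm_mul, norm_prod]
      ring
    rw [h5]
    exact one_le_mul_of_one_le_of_one_le (one_le_mul_of_one_le_of_one_le h3 h3) h4
  have hM0 : M z₀ ≠ 0 := by
    intro h
    rw [h, norm_zero, mul_zero] at hMlow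
    linarith
  have hMinv : ‖(M z₀)⁻¹‖ ≤ E ^ 2 * P := by
    rw [norm_inv]
    exact inv_le_of_inv_le₀ (by positivity)
      ((inv_le_iff_one_le_mul₀' (by positivity)).2 (by linarith))
  have hbound : ∀ q : ℝ, 0 ≤ q → q ≤ 2 / τ + b + 1 → ‖(M z₀)⁻¹‖ * (q * (Q * P * τ⁻¹)) ≤
      (2 + τ) / τ * Q * τ⁻¹ * Real.exp (3 * A₃ + 2 * A₂) *
        Real.exp ((3 * A₃ + 2 * A₂) * b ^ κ) := by
    intro q hq0 hq
    have h1 : q ≤ (2 + τ) / τ * E := by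
      refine hq.trans (le_trans ?_ (mul_le_mul_of_nonneg_left hE1 (by positivity)))
      have : (2 + τ) / τ * (1 + τ * b) = 2 / τ + 1 + 2 * b + τ * b := by field_simp; ring
      rw [this]
      nlinarith [mul_nonneg hτ0.le hb]
    calc ‖(M z₀)⁻¹‖ * (q * (Q * P * τ⁻¹)) ≤ (E ^ 2 * P) * ((2 + τ) / τ * E * (Q * P * τ⁻¹)) := by
          gcongr
      _ = (2 + τ) / τ * Q * τ⁻¹ * (E ^ 3 * P ^ 2) := by ring
      _ = _ := by
          have : E ^ 3 * P ^ 2 = Real.exp (3 * A₃ + 2 * A₂) *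
              Real.exp ((3 * A₃ + 2 * A₂) * b ^ κ) := by
            rw [hE, hP, ← Real.exp_nat_mul, ← Real.exp_nat_mul, ← Real.exp_add, ← Real.exp_add]
            congr 1
            push_cast
            ring
          rw [this]
          ring
  have hboxd : ∀ {c : ℝ}, 0 < c → Differentiable ℂ (boxFT c) := fun hc =>
    (isTransform_box hc).differentiable
  have hMd : Differentiable ℂ M :=
    (hboxd hτ0).mul ((Differentiable.fun_finsetProd fun j _ => hboxd (ha0 j)).mul (hboxd hτ0))
  have hTτ : 3 * τ + τ ≤ T := by rw [hτ]; linarith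
  refine ⟨fun z => (M z₀)⁻¹ * M z, hMd.const_mul _, inv_mul_cancel₀ hM0, ?_, ?_⟩
  · have h1 := (hbase.mul_box hτ0).const_mul (M z₀)⁻¹
    have h2 := hbound 1 zero_le_one (by linarith [div_pos two_pos hτ0])
    rw [one_mul] at h2
    convert h1.mono hTτ h2 using 2 with z
    simp only [hM]
    ring
  · have h1 := (hbase.mul_linear_box hτ0 hb).const_mul (M z₀)⁻¹
    have h2 := hbound (2 / τ + b) (by positivity) (by linarith)
    convert h1.mono hTτ h2 using 2 with z
    simp only [hM]
    ring

/-! ### First-order interpolation at finitely many nodes. -/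

/-- `z ↦ -i ∫ t f(t) e^{-izt} dt`, the derivative of `ft f`. -/
noncomputable def ftDeriv (f : ℝ → ℂ) (z : ℂ) : ℂ :=
  -(Complex.I * ∫ t : ℝ, f t * (t * Complex.exp (-(Complex.I * z * t))))

/-- At depth `b ≥ 0` the kernel has modulus `e^{-bt} ≤ 1` on `[0, T]`, so no exponential in `b` is
lost. -/
lemma IsWindow.norm_ftDeriv_le {T c b : ℝ} {f : ℝ → ℂ} (h : IsWindow T c f) (hT : 0 ≤ T)
    (x : ℝ) (hb : 0 ≤ b) : ‖ftDeriv f (x - Complex.I * b)‖ ≤ T ^ 2 * c := by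
  have hc := h.nonneg
  rw [ftDeriv, norm_neg, norm_mul, Complex.norm_I, one_mul,
    ← MeasureTheory.setIntegral_eq_integral_of_forall_compl_eq_zero (s := Set.Icc 0 T)
      fun t ht => by rw [h.supp t ht, zero_mul]]
  refine (MeasureTheory.norm_setIntegral_le_of_norm_le_const (C := c * T) ?_ fun t ht => ?_).trans
    (le_of_eq ?_)
  · simp
  · rw [norm_mul, norm_mul, Complex.norm_real, Real.norm_of_nonneg ht.1, Complex.norm_exp]
    have h1 : (-(Complex.I * (x - Complex.I * b) * t)).re = -(b * t) := by
      simp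
    have h2 : Real.exp (-(b * t)) ≤ 1 :=
      Real.exp_le_one_iff.2 (neg_nonpos.2 (mul_nonneg hb ht.1))
    rw [h1]
    have h3 := ht.1
    calc ‖f t‖ * (t * Real.exp (-(b * t))) ≤ c * (T * 1) := by
          gcongr
          exacts [h.bound t, ht.2]
      _ = c * T := by ring
  · simp [MeasureTheory.measureReal_def, hT]
    ring

lemma hasDerivAt_sq_mul_zero {G : ℂ → ℂ} (hG : Differentiable ℂ G) (p : ℂ) :
    HasDerivAt (fun z => (z - p) ^ 2 * G z) 0 p := by
  have h1 : HasDerivAt (fun z : ℂ => (z - p) ^ 2) ((2 : ℕ) * (p - p) ^ (2 - 1) * 1) p :=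
    ((hasDerivAt_id p).sub_const p).pow 2
  refine (h1.mul (hG p).hasDerivAt).congr_deriv ?_
  simp

/-- Finitely many interpolation conditions of first order, solved with norm control. -/
lemma exists_window_of_card_le {κ T B : ℝ} (hκ₀ : 0 < κ) (hκ₁ : κ < 1) (hT : 0 < T)
    (hB : 0 < B) :
    ∃ C C' : ℝ, 0 < C ∧ 0 < C' ∧ ∀ (ι : Type) (F : Finset ι) (μ : ι → ℂ) (x b : ℝ), 0 ≤ b →
      (∀ S ⊆ F, ∀ r, 0 ≤ r → (∀ i ∈ S, ‖μ i‖ ≤ r) → (S.card : ℝ) ≤ B * r ^ κ) →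
      ∃ f₁ f₂ : ℝ → ℂ, IsWindow T (C * Real.exp (C' * b ^ κ)) f₁ ∧
        IsWindow T (C * Real.exp (C' * b ^ κ)) f₂ ∧
        (ft f₁ (x - Complex.I * b) = 1 ∧ ftDeriv f₁ (x - Complex.I * b) = 0) ∧
        (ft f₂ (x - Complex.I * b) = 0 ∧ ftDeriv f₂ (x - Complex.I * b) = -Complex.I) ∧
        ∀ i ∈ F, (ft f₁ (x - Complex.I * b + μ i) = 0 ∧ ftDeriv f₁ (x - Complex.I * b + μ i) = 0) ∧
          (ft f₂ (x - Complex.I * b + μ i) = 0 ∧ ftDeriv f₂ (x - Complex.I * b + μ i) = 0) := by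
  classical
  obtain ⟨C, C', hC, hC', key⟩ := exists_transform_of_card_le hκ₀ hκ₁ hT hB
  -- The correction by `α`, with `|α| ≤ T ^ 2 * C * e`, multiplies a second bound `C * e`; hence the
  -- square of `C` and the doubled exponent.
  refine ⟨C + T ^ 2 * C ^ 2, 2 * C', by positivity, by positivity, ?_⟩
  intro ι F μ x b hb hF
  obtain ⟨R, hRd, hR1, hH, hwH⟩ := key ι F μ b hb hF
  have hμ : ∀ i ∈ F, μ i ≠ 0 := by
    intro i hi h0
    have := hF {i} (by simpa using hi) 0 le_rfl (by simp [h0])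
    rw [Real.zero_rpow hκ₀.ne'] at this
    norm_num at this
  set e : ℝ := Real.exp (C' * b ^ κ) with he
  have he1 : 1 ≤ e := Real.one_le_exp (by positivity)
  have he2 : Real.exp (2 * C' * b ^ κ) = e ^ 2 := by
    rw [he, ← Real.exp_nat_mul]
    congr 1
    push_cast
    ring
  rw [he2]
  set p : ℂ := x - Complex.I * b with hp
  set H : ℂ → ℂ := fun z => (∏ i ∈ F, (1 - (z - p) / μ i) ^ 2) * R (z - x) with hHdef
  have hsub : ∀ z : ℂ, z - x + Complex.I * b = z - p := fun z => by rw [hp]; ring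
  have hH' : IsTransform T (C * e) H := by
    have := hH.comp_sub_real x
    simp only [hsub] at this
    exact this
  have hwH' : IsTransform T (C * e) (fun z => (z - p) * H z) := by
    have := hwH.comp_sub_real x
    simp only [hsub] at this
    exact this
  have hHp : H p = 1 := by
    have h1 : p - x = -(Complex.I * b) := by rw [hp]; ring
    simp [hHdef, h1, hR1]
  obtain ⟨f, hf, hfH⟩ := hH'
  have hHderiv : ∀ z, HasDerivAt H (ftDeriv f z) z := by
    have : ft f = H := funext hfH
    intro z
    have h1 := hf.hasDerivAt_ft z
    rwa [this] at h1
  set α : ℂ := ftDeriv f p with hα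
  have hαn : ‖α‖ ≤ T ^ 2 * (C * e) := hf.norm_ftDeriv_le hT.le x hb
  -- the double zeros
  have hzero : ∀ i ∈ F, H (p + μ i) = 0 ∧ ftDeriv f (p + μ i) = 0 := by
    intro i hi
    have hμi := hμ i hi
    set G : ℂ → ℂ := fun z => ((μ i)⁻¹) ^ 2 *
      ((∏ j ∈ F.erase i, (1 - (z - p) / μ j) ^ 2) * R (z - x)) with hG
    have hGd : Differentiable ℂ G := by
      refine Differentiable.const_mul (Differentiable.mul ?_ ?_) _
      · exact Differentiable.fun_finsetProd fun j _ => by fun_prop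
      · exact hRd.comp (differentiable_id.sub_const _)
    have hfac : H = fun z => (z - (p + μ i)) ^ 2 * G z := by
      ext z
      simp only [hHdef, hG]
      rw [← Finset.mul_prod_erase F _ hi]
      field_simp
      ring
    refine ⟨by simp [hfac], ?_⟩
    have h1 := hasDerivAt_sq_mul_zero hGd (p + μ i)
    rw [← hfac] at h1
    exact (hHderiv _).unique h1
  have hlin : ∀ z : ℂ, HasDerivAt (fun z : ℂ => z - p) 1 z := fun z =>
    (hasDerivAt_id z).sub_const p
  have hwderiv : ∀ z, HasDerivAt (fun z => (z - p) * H z) (H z + (z - p) * ftDeriv f z) z := by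
    intro z
    refine ((hlin z).mul (hHderiv z)).congr_deriv ?_
    ring
  -- With `H(p) = 1` and `α = H'(p)`, the function `H - α (z - p) H` has value `1` and derivative
  -- `0` at `p`, and `-i (z - p) H` has value `0` and derivative `-i`, the latter cancelling the `i`
  -- in `IsWindow.pairing_tExpFun`. Both keep the double zeros of `H`.
  have h₁ := IsTransform.add (show IsTransform T (C * e) H from ⟨f, hf, hfH⟩) (hwH'.const_mul (-α))
  have h₂ := hwH'.const_mul (-Complex.I)
  have hd₁ : ∀ z, HasDerivAt (fun z => H z + -α * ((z - p) * H z))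
      (ftDeriv f z + -α * (H z + (z - p) * ftDeriv f z)) z := fun z =>
    (hHderiv z).add ((hwderiv z).const_mul _)
  have hd₂ : ∀ z, HasDerivAt (fun z => -Complex.I * ((z - p) * H z))
      (-Complex.I * (H z + (z - p) * ftDeriv f z)) z := fun z => (hwderiv z).const_mul _
  have hb₁ : C * e + ‖-α‖ * (C * e) ≤ (C + T ^ 2 * C ^ 2) * e ^ 2 := by
    rw [norm_neg]
    have h3 : ‖α‖ * (C * e) ≤ T ^ 2 * (C * e) * (C * e) := by gcongr
    have h4 : C * e ≤ C * e ^ 2 := by gcongr; nlinarith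
    nlinarith
  have hb₂ : ‖-Complex.I‖ * (C * e) ≤ (C + T ^ 2 * C ^ 2) * e ^ 2 := by
    rw [norm_neg, Complex.norm_I, one_mul]
    have h4 : C * e ≤ C * e ^ 2 := by gcongr; nlinarith
    have h5 : 0 ≤ T ^ 2 * C ^ 2 * e ^ 2 := by positivity
    nlinarith
  obtain ⟨f₁, hf₁, hG₁⟩ := h₁.mono le_rfl hb₁
  obtain ⟨f₂, hf₂, hG₂⟩ := h₂.mono le_rfl hb₂
  have hD₁ : ∀ z, ftDeriv f₁ z = ftDeriv f z + -α * (H z + (z - p) * ftDeriv f z) := fun z => by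
    have h3 := hf₁.hasDerivAt_ft z
    rw [show ft f₁ = _ from funext hG₁] at h3
    exact h3.unique (hd₁ z)
  have hD₂ : ∀ z, ftDeriv f₂ z = -Complex.I * (H z + (z - p) * ftDeriv f z) := fun z => by
    have h3 := hf₂.hasDerivAt_ft z
    rw [show ft f₂ = _ from funext hG₂] at h3
    exact h3.unique (hd₂ z)
  refine ⟨f₁, f₂, hf₁, hf₂, ⟨?_, ?_⟩, ⟨?_, ?_⟩, fun i hi => ⟨⟨?_, ?_⟩, ?_, ?_⟩⟩
  · simp [hG₁, hHp]
  · simp [hD₁, hHp, ← hα]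
  · simp [hG₂]
  · simp [hD₂, hHp]
  · simp [hG₁, hzero i hi]
  · simp [hD₁, hzero i hi]
  · simp [hG₂, hzero i hi]
  · simp [hD₂, hzero i hi]

/-! ### From finitely many conditions to all of them. -/

/-- A moment problem in a Hilbert space is solvable with norm at most `M` as soon as all its
finite subproblems are. -/
lemma exists_inner_eq_of_finite {H : Type*} [NormedAddCommGroup H] [InnerProductSpace ℂ H]
    [CompleteSpace H] {ι : Type*} (v : ι → H) (c : ι → ℂ) (M : ℝ)
    (h : ∀ F : Finset ι, ∃ g : H, ‖g‖ ≤ M ∧ ∀ i ∈ F, inner ℂ (v i) g = c i) :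
    ∃ g : H, ‖g‖ ≤ M ∧ ∀ i, inner ℂ (v i) g = c i := by
  classical
  set K : Set (WeakDual ℂ H) := WeakDual.toStrongDual ⁻¹' Metric.closedBall 0 M with hK
  -- Banach–Alaoglu. Each condition is weak-* closed, so the finite intersection property applies;
  -- the Riesz isometry is conjugate-linear, hence the conjugated moments.
  have hKc : IsCompact K := WeakDual.isCompact_closedBall _ _
  set t : ι → Set (WeakDual ℂ H) := fun i => {φ | φ (v i) = starRingEnd ℂ (c i)} with ht
  have htc : ∀ i, IsClosed (t i) := fun i =>
    isClosed_eq (WeakDual.eval_continuous (v i)) continuous_const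
  have hne : (K ∩ ⋂ i, t i).Nonempty := by
    refine hKc.inter_iInter_nonempty t htc fun F => ?_
    obtain ⟨g, hg, hgF⟩ := h F
    refine ⟨StrongDual.toWeakDual (InnerProductSpace.toDual ℂ H g), ?_, ?_⟩
    · rw [hK, Set.mem_preimage, mem_closedBall_zero_iff]
      refine le_trans (le_of_eq ?_) hg
      exact (InnerProductSpace.toDual ℂ H).norm_map g
    · simp only [Set.mem_iInter, ht, Set.mem_ofPred_eq]
      intro i hi
      rw [← hgF i hi, inner_conj_symm]
      exact InnerProductSpace.toDual_apply_apply
  obtain ⟨φ, hφK, hφt⟩ := hne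
  refine ⟨(InnerProductSpace.toDual ℂ H).symm (WeakDual.toStrongDual φ), ?_, fun i => ?_⟩
  · rw [LinearIsometryEquiv.norm_map]
    simpa [hK] using hφK
  · have h1 : φ (v i) = starRingEnd ℂ (c i) := Set.mem_iInter.1 hφt i
    rw [← inner_conj_symm, InnerProductSpace.toDual_symm_apply]
    change starRingEnd ℂ (φ (v i)) = _
    rw [h1, Complex.conj_conj]

open MeasureTheory in
lemma IsWindow.memL2 {T c : ℝ} {f : ℝ → ℂ} (h : IsWindow T c f) : MemL2 T f :=
  MemLp.of_bound h.meas.aestronglyMeasurable c (Filter.Eventually.of_forall h.bound)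

open MeasureTheory in
lemma Continuous.memL2 {v : ℝ → ℂ} (hv : Continuous v) (T : ℝ) : MemL2 T v := by
  obtain ⟨C, hC⟩ := isCompact_Icc.exists_bound_of_continuousOn (s := Set.Icc 0 T) hv.continuousOn
  refine MemLp.of_bound hv.aestronglyMeasurable C ?_
  rw [ae_restrict_iff' measurableSet_Ioo]
  exact Filter.Eventually.of_forall fun t ht => hC t (Set.Ioo_subset_Icc_self ht)

open MeasureTheory in
lemma IsWindow.normL2_le {T c : ℝ} {f : ℝ → ℂ} (h : IsWindow T c f) (hT : 0 ≤ T) :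
    normL2 T f ≤ √T * c := by
  have h1 := eLpNorm_le_of_ae_bound (p := 2) (μ := volume.restrict (Set.Ioo 0 T))
    (Filter.Eventually.of_forall h.bound)
  rw [normL2]
  refine (ENNReal.toReal_mono (by finiteness) h1).trans (le_of_eq ?_)
  rw [ENNReal.toReal_mul, ENNReal.toReal_ofReal h.nonneg, ← ENNReal.toReal_rpow]
  simp [Real.sqrt_eq_rpow, hT]

open MeasureTheory in
lemma pairing_eq_setIntegral {T : ℝ} (hT : 0 ≤ T) (f v : ℝ → ℂ) :
    pairing T f v = ∫ t in Set.Ioo 0 T, f t * (starRingEnd ℂ) (v t) := by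
  rw [pairing, intervalIntegral.integral_of_le hT, integral_Ioc_eq_integral_Ioo]

open MeasureTheory in
lemma inner_toLp_eq_pairing {T : ℝ} (hT : 0 ≤ T) {v f : ℝ → ℂ} (hv : MemL2 T v)
    (g : Lp ℂ 2 (volume.restrict (Set.Ioo 0 T)))
    (hgf : g =ᵐ[volume.restrict (Set.Ioo 0 T)] f) :
    inner ℂ (MemLp.toLp v hv) g = pairing T f v := by
  rw [L2.inner_def, pairing_eq_setIntegral hT]
  refine integral_congr_ae ?_
  filter_upwards [MemLp.coeFn_toLp hv, hgf] with t h1 h2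
  rw [h1, h2, RCLike.inner_apply]

open MeasureTheory in
lemma IsWindow.pairing_expFun {T c : ℝ} {f : ℝ → ℂ} (h : IsWindow T c f) (hT : 0 ≤ T) (l : ℂ) :
    pairing T f (expFun l) = ft f (starRingEnd ℂ l) := by
  rw [pairing, intervalIntegral.integral_of_le hT, ← integral_Icc_eq_integral_Ioc, ft,
    ← setIntegral_eq_integral_of_forall_compl_eq_zero (μ := volume) (s := Set.Icc 0 T)
      fun t ht => by rw [h.supp t ht, zero_mul]]
  simp [expFun, ← Complex.exp_conj]

open MeasureTheory in
lemma IsWindow.pairing_tExpFun {T c : ℝ} {f : ℝ → ℂ} (h : IsWindow T c f) (hT : 0 ≤ T) (l : ℂ) :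
    pairing T f (tExpFun l) = Complex.I * ftDeriv f (starRingEnd ℂ l) := by
  rw [ftDeriv, mul_neg, ← mul_assoc, Complex.I_mul_I, neg_one_mul, neg_neg, pairing,
    intervalIntegral.integral_of_le hT, ← integral_Icc_eq_integral_Ioc,
    ← setIntegral_eq_integral_of_forall_compl_eq_zero (μ := volume) (s := Set.Icc 0 T)
      fun t ht => by rw [h.supp t ht, zero_mul]]
  simp [tExpFun, ← Complex.exp_conj]

lemma continuous_expFun (l : ℂ) : Continuous (expFun l) := by
  unfold expFun; fun_prop

lemma continuous_tExpFun (l : ℂ) : Continuous (tExpFun l) := by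
  unfold tExpFun; fun_prop

open MeasureTheory in
/-- Prescribed moments against exponentials are attained with norm at most `M` as soon as finitely
many are. -/
lemma exists_memL2_of_finite {T M : ℝ} (hT : 0 ≤ T) {ι : Type} (l : ι → ℂ) (c d : ι → ℂ)
    (h : ∀ F : Finset ι, ∃ f, MemL2 T f ∧ normL2 T f ≤ M ∧
      ∀ i ∈ F, pairing T f (expFun (l i)) = c i ∧ pairing T f (tExpFun (l i)) = d i) :
    ∃ g, MemL2 T g ∧ normL2 T g ≤ M ∧
      ∀ i, pairing T g (expFun (l i)) = c i ∧ pairing T g (tExpFun (l i)) = d i := by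
  classical
  set v : ι ⊕ ι → Lp ℂ 2 (volume.restrict (Set.Ioo 0 T)) := Sum.elim
    (fun i => MemLp.toLp _ ((continuous_expFun (l i)).memL2 T))
    (fun i => MemLp.toLp _ ((continuous_tExpFun (l i)).memL2 T)) with hv
  obtain ⟨g, hgM, hg⟩ := exists_inner_eq_of_finite v (Sum.elim c d) M fun F => by
    obtain ⟨f, hf, hfM, hfF⟩ := h (F.image (Sum.elim id id))
    refine ⟨MemLp.toLp f hf, ?_, ?_⟩
    · exact (Lp.norm_toLp f hf).trans_le hfM
    · rintro (i | i) hi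
      · exact (inner_toLp_eq_pairing hT ((continuous_expFun (l i)).memL2 T) _
          (MemLp.coeFn_toLp hf)).trans
          (hfF i (Finset.mem_image.2 ⟨_, hi, rfl⟩)).1
      · exact (inner_toLp_eq_pairing hT ((continuous_tExpFun (l i)).memL2 T) _
          (MemLp.coeFn_toLp hf)).trans
          (hfF i (Finset.mem_image.2 ⟨_, hi, rfl⟩)).2
  refine ⟨g, Lp.memLp g, hgM, fun i => ⟨?_, ?_⟩⟩
  · rw [← inner_toLp_eq_pairing hT ((continuous_expFun (l i)).memL2 T) g (ae_eq_refl _)]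
    exact hg (Sum.inl i)
  · rw [← inner_toLp_eq_pairing hT ((continuous_tExpFun (l i)).memL2 T) g (ae_eq_refl _)]
    exact hg (Sum.inr i)

/-! ### Counting frequencies and conclusion. -/

lemma IsDensityBound.le_norm_sub {L : Set ℤ} {lam : L → ℂ} {ν : ℝ → ℝ} (h : IsDensityBound lam ν)
    {R₀ : ℝ} (hν : ∀ r : ℝ, 0 ≤ r → r < R₀ → ν r = 0) {m n : L} (hnm : n ≠ m) :
    R₀ ≤ ‖lam n - lam m‖ := by
  by_contra! hlt
  have hd := norm_nonneg (lam n - lam m)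
  -- The midpoint lies strictly above the distance, so that `n` is counted, and strictly below `R₀`,
  -- so that `ν r = 0`.
  set r := (‖lam n - lam m‖ + R₀) / 2 with hr
  have hr0 : 0 ≤ r := by linarith
  have h1 := h.card_le r hr0 m
  rw [hν r hr0 (by linarith)] at h1
  have h2 : {n : L | n ≠ m ∧ ‖lam n - lam m‖ < r}.ncard = 0 := by
    exact_mod_cast le_antisymm h1 (Nat.cast_nonneg _)
  rw [Set.ncard_eq_zero (h.finite r hr0 m)] at h2
  have h3 : n ∈ {n : L | n ≠ m ∧ ‖lam n - lam m‖ < r} := ⟨hnm, by linarith⟩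
  rw [h2] at h3
  exact h3

lemma IsDensityBound.card_le_rpow {L : Set ℤ} {lam : L → ℂ} {ν : ℝ → ℝ}
    (h : IsDensityBound lam ν) {κ R₀ R₁ C₁ : ℝ} (hκ : 0 < κ) (hR₀ : 0 < R₀) (hR₁ : R₀ ≤ R₁)
    (hC₁ : 0 ≤ C₁) (hν : ∀ r : ℝ, 0 ≤ r → r < R₀ → ν r = 0)
    (hν₁ : ∀ r : ℝ, R₁ ≤ r → ν r ≤ C₁ * r ^ κ) {m : L} {S : Finset L} (hS : m ∉ S) {r : ℝ}
    (hr : 0 ≤ r) (hSr : ∀ n ∈ S, ‖lam n - lam m‖ ≤ r) :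
    (S.card : ℝ) ≤ C₁ * (2 * R₁ / R₀) ^ κ * r ^ κ := by
  have hR₁' : 0 < R₁ := hR₀.trans_le hR₁
  rcases S.eq_empty_or_nonempty with rfl | ⟨n, hn⟩
  · simp only [Finset.card_empty, Nat.cast_zero]
    positivity
  have hne : ∀ n ∈ S, n ≠ m := fun n hn h' => hS (h' ▸ hn)
  have hrR : R₀ ≤ r := (h.le_norm_sub hν (hne n hn)).trans (hSr n hn)
  -- Doubling passes from a closed ball to an open one, and `R₁` is where the power bound starts. As
  -- `r ≥ R₀`, this enlarges `r` by a factor of at most `2 * R₁ / R₀`.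
  set q := max (2 * r) R₁ with hq
  have hq0 : 0 ≤ q := hR₁'.le.trans (le_max_right _ _)
  have h1 : S.card ≤ {n : L | n ≠ m ∧ ‖lam n - lam m‖ < q}.ncard := by
    rw [← Set.ncard_coe_finset]
    refine Set.ncard_le_ncard (fun n hn => ⟨hne n hn, ?_⟩) (h.finite q hq0 m)
    exact (hSr n hn).trans_lt ((by linarith : r < 2 * r).trans_le (le_max_left _ _))
  have h2 : q ≤ 2 * R₁ / R₀ * r := by
    rw [div_mul_eq_mul_div, le_div_iff₀ hR₀]
    refine (mul_le_mul_of_nonneg_right (max_le_iff.2 ⟨?_, ?_⟩ :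
      q ≤ 2 * R₁ * r / R₀) hR₀.le).trans (le_of_eq (by field_simp))
    · rw [le_div_iff₀ hR₀]; nlinarith
    · rw [le_div_iff₀ hR₀]; nlinarith
  calc (S.card : ℝ) ≤ ({n : L | n ≠ m ∧ ‖lam n - lam m‖ < q}.ncard : ℝ) := by exact_mod_cast h1
    _ ≤ C₁ * q ^ κ := (h.card_le q hq0 m).trans (hν₁ q (le_max_right _ _))
    _ ≤ C₁ * (2 * R₁ / R₀ * r) ^ κ := by gcongr
    _ = _ := by rw [Real.mul_rpow (by positivity) hr, mul_assoc]

theorem proposition1 (κ T R₀ R₁ C₀ C₁ : ℝ) (hκ₀ : 0 < κ) (hκ₁ : κ < 1) (hT : 0 < T)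
    (hR₀ : 0 < R₀) (hR₁ : R₀ ≤ R₁) (hC₀ : 0 < C₀) (hC₁ : 0 < C₁) :
    ∃ C₂ C₃ : ℝ, 0 < C₂ ∧ 0 < C₃ ∧
      ∀ (L : Set ℤ) (lam : L → ℂ) (ν : ℝ → ℝ),
        (∀ n : L, 0 ≤ (lam n).im) →
        IsDensityBound lam ν →
        (∀ r : ℝ, 0 ≤ r → r < R₀ → ν r = 0) →
        (∀ r : ℝ, R₁ ≤ r → C₀ * r ^ κ ≤ ν r ∧ ν r ≤ C₁ * r ^ κ) →
        ∃ g₁ g₂ : L → ℝ → ℂ,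
          (∀ m : L, MemL2 T (g₁ m) ∧ MemL2 T (g₂ m)) ∧
          (∀ m n : L,
            pairing T (g₁ m) (tExpFun (lam n)) = 0 ∧
            pairing T (g₁ m) (expFun (lam n)) = (if m = n then 1 else 0) ∧
            pairing T (g₂ m) (tExpFun (lam n)) = (if m = n then 1 else 0) ∧
            pairing T (g₂ m) (expFun (lam n)) = 0) ∧
          (∀ m : L,
            normL2 T (g₁ m) ≤ C₂ * Real.exp (C₃ * (lam m).im ^ κ) ∧
            normL2 T (g₂ m) ≤ C₂ * Real.exp (C₃ * (lam m).im ^ κ)) := by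
  classical
  have hR₁' : 0 < R₁ := hR₀.trans_le hR₁
  obtain ⟨C, C', hC, hC', key⟩ := exists_window_of_card_le hκ₀ hκ₁ hT
    (B := C₁ * (2 * R₁ / R₀) ^ κ) (by positivity)
  refine ⟨√T * C, C', by positivity, hC', ?_⟩
  intro L lam ν him hdens hν hν₁
  have hfin : ∀ (m : L) (F : Finset L), ∃ f₁ f₂,
      (MemL2 T f₁ ∧ normL2 T f₁ ≤ √T * C * Real.exp (C' * (lam m).im ^ κ) ∧
        ∀ n ∈ F, pairing T f₁ (expFun (lam n)) = (if m = n then 1 else 0) ∧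
          pairing T f₁ (tExpFun (lam n)) = 0) ∧
      (MemL2 T f₂ ∧ normL2 T f₂ ≤ √T * C * Real.exp (C' * (lam m).im ^ κ) ∧
        ∀ n ∈ F, pairing T f₂ (expFun (lam n)) = 0 ∧
          pairing T f₂ (tExpFun (lam n)) = (if m = n then 1 else 0)) := by
    intro m F
    -- Nodes are conjugated because the pairing conjugates its second argument. Thus `Im (λ m) ≥ 0`
    -- places the base point at depth `b = Im (λ m)` in the closed lower half-plane.
    obtain ⟨f₁, f₂, hf₁, hf₂, hm₁, hm₂, hz⟩ := key L (F.erase m)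
      (fun n => starRingEnd ℂ (lam n) - starRingEnd ℂ (lam m)) (lam m).re (lam m).im (him m)
      fun S hS r hr hSr => hdens.card_le_rpow hκ₀ hR₀ hR₁ hC₁.le hν (fun r hr => (hν₁ r hr).2)
        (fun hm => Finset.notMem_erase m F (hS hm)) hr fun n hn => by
          have h1 := hSr n hn
          rwa [← map_sub, RCLike.norm_conj] at h1
    have hconj : ((lam m).re : ℂ) - Complex.I * (lam m).im = starRingEnd ℂ (lam m) := by
      apply Complex.ext <;> simp
    simp only [hconj, add_sub_cancel] at hm₁ hm₂ hz
    refine ⟨f₁, f₂, ⟨hf₁.memL2, (hf₁.normL2_le hT.le).trans_eq (by ring), fun n hn => ?_⟩,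
      hf₂.memL2, (hf₂.normL2_le hT.le).trans_eq (by ring), fun n hn => ?_⟩
    · rw [hf₁.pairing_expFun hT.le, hf₁.pairing_tExpFun hT.le]
      rcases eq_or_ne m n with rfl | hmn
      · simp [hm₁]
      · simp [hmn, hz n (Finset.mem_erase.2 ⟨hmn.symm, hn⟩)]
    · rw [hf₂.pairing_expFun hT.le, hf₂.pairing_tExpFun hT.le]
      rcases eq_or_ne m n with rfl | hmn
      · simp [hm₂]
      · simp [hmn, hz n (Finset.mem_erase.2 ⟨hmn.symm, hn⟩)]
  have h₁ := fun m => exists_memL2_of_finite hT.le lam (fun n => if m = n then 1 else 0)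
    (fun _ => 0) fun F => by
      obtain ⟨f₁, -, h, -⟩ := hfin m F
      exact ⟨f₁, h⟩
  have h₂ := fun m => exists_memL2_of_finite hT.le lam (fun _ => 0)
    (fun n => if m = n then 1 else 0) fun F => by
      obtain ⟨-, f₂, -, h⟩ := hfin m F
      exact ⟨f₂, h⟩
  choose g₁ hg₁ hn₁ hp₁ using h₁
  choose g₂ hg₂ hn₂ hp₂ using h₂
  exact ⟨g₁, g₂, fun m => ⟨hg₁ m, hg₂ m⟩,
    fun m n => ⟨(hp₁ m n).2, (hp₁ m n).1, (hp₂ m n).2, (hp₂ m n).1⟩,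
    fun m => ⟨hn₁ m, hn₂ m⟩⟩
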